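/- Let $\omega_1,\omega_3\in\mathbb C$ with $\operatorname{Im}(\omega_3/\omega_1)>0$, let $p,q$ be elliptic functions (meromorphic on $\mathbb C$ with periods $2\omega_1$ and $2\omega_3$), and put $$J=\begin{pmatrix} i&0\\0&-i\end{pmatrix},\qquad Q(x)=\begin{pmatrix}0&-iq(x)\\ ip(x)&0\end{pmatrix}.$$ For $j=1,3$ let $t_j=\omega_j/|\omega_j|$, and fix $x_0\in\mathbb C$ such that no pole of $Q$ lies on the line through $x_0$ and $x_0+2\omega_1$ or on the line through $x_0$ and $x_0+2\omega_3$. For $\zeta\in\mathbb R$ put $Q_j(\zeta)=t_jQ(t_j\zeta+x_0)$, which has period $2|\omega_j|$. A number $E\in\mathbb C$ is called a $4\omega_j$-periodic eigenvalue associated with $Q$ if $t_jE$ is an eigenvalue of the operator $y\mapsto Jy'+Q_jy$ in $L^2([0,4|\omega_j|])^2$ whose domain consists of all absolutely continuous $y$ with $Jy'+Q_jy\in L^2([0,4|\omega_j|])^2$ and $y(4|\omega_j|)=y(0)$; it is called a $2\omega_j$-periodic (respectively $2\omega_j$-semi-periodic) eigenvalue if the same holds with the interval $[0,2|\omega_j|]$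 and the boundary condition $y(2|\omega_j|)=y(0)$ (respectively $y(2|\omega_j|)=-y(0)$). Then, for $j=1,3$, the $4\omega_j$-periodic eigenvalues are exactly the $2\omega_j$-periodic and the $2\omega_j$-semi-periodic ones, and there are constants $C_1,C_3>0$ such that all $4\omega_j$-periodic eigenvalues lie in the strip $$S_j=\{E\in\mathbb C : |\operatorname{Im}(t_jE)|\le C_j\}.$$ The axes $\{E: \operatorname{Im}(t_jE)=0\}$ of $S_1$ and $S_3$ meet at the angle $\theta\in(0,\pi)$ given by $e^{i\theta}=\frac{\omega_3}{\omega_1}\left|\frac{\omega_1}{\omega_3}\right|$; more precisely, rotating the axis of $S_3$ counterclockwise about $0$ by $\theta$ gives the axis of $S_1$. In particular there is $R>0$ such that $S_1\cap S_3$ contains no $E$ with $|E|>R$. -/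

import Mathlib

open Complex MeasureTheory Set
open scoped Matrix

noncomputable section

namespace AKNS

/-- A meromorphic function on `ℂ` with periods `2ω₁` and `2ω₃`. Normal form only fixes the values
of `f` pointwise: `f` is analytic at every point that is not a pole, and has the conventional
value `0` at its poles. -/
structure IsElliptic (ω₁ ω₃ : ℂ) (f : ℂ → ℂ) : Prop where
  meromorphic : MeromorphicNFOn f Set.univ
  periodic₁ : ∀ z, f (z + 2 * ω₁) = f z
  periodic₃ : ∀ z, f (z + 2 * ω₃) = f z

/-- `z` is a pole of the meromorphic function `f`. -/
def IsPole (f : ℂ → ℂ) (z : ℂ) : Prop := meromorphicOrderAt f z < 0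

/-- The matrix `J = diag(i, -i)`. -/
def J : Matrix (Fin 2) (Fin 2) ℂ := !![I, 0; 0, -I]

/-- The potential `Q` with zero diagonal and off-diagonal entries `-iq`, `ip`. -/
def Q (p q : ℂ → ℂ) (x : ℂ) : Matrix (Fin 2) (Fin 2) ℂ :=
  !![0, -I * q x; I * p x, 0]

/-- The unit direction `t = ω / |ω|`. -/
def dir (ω : ℂ) : ℂ := ω / (‖ω‖ : ℂ)

/-- No pole of `Q` lies on the line through `x₀` and `x₀ + 2ω`. -/
def NoPoleOnLine (p q : ℂ → ℂ) (x₀ ω : ℂ) : Prop :=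
  ∀ s : ℝ, ¬ IsPole p (dir ω * s + x₀) ∧ ¬ IsPole q (dir ω * s + x₀)

/-- The potential on the real line, `ζ ↦ t Q(tζ + x₀)` with `t = ω / |ω|`; its period is
`2|ω|`. -/
def lineQ (p q : ℂ → ℂ) (x₀ ω : ℂ) (ζ : ℝ) : Matrix (Fin 2) (Fin 2) ℂ :=
  dir ω • Q p q (dir ω * ζ + x₀)

/-- The differential expression `Ly = Jy' + Vy` on the real line. -/
def L (V : ℝ → Matrix (Fin 2) (Fin 2) ℂ) (y : ℝ → Fin 2 → ℂ) (ζ : ℝ) : Fin 2 → ℂ :=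
  J *ᵥ deriv y ζ + V ζ *ᵥ y ζ

/-- Domain of the realization of `L` in `L²([a,b])²` with boundary condition `y(b) = σ y(a)`. -/
structure InDomain (V : ℝ → Matrix (Fin 2) (Fin 2) ℂ) (a b : ℝ) (σ : ℂ)
    (y : ℝ → Fin 2 → ℂ) : Prop where
  memLp : MemLp y 2 (volume.restrict (Icc a b))
  absolutelyContinuous : AbsolutelyContinuousOnInterval y a b
  boundary : y b = σ • y a
  memLp_L : MemLp (L V y) 2 (volume.restrict (Icc a b))

/-- `μ` is an eigenvalue of the realization of `L` in `L²([a,b])²` with `y(b) = σ y(a)`. -/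
def IsEigenvalue (V : ℝ → Matrix (Fin 2) (Fin 2) ℂ) (a b : ℝ) (σ μ : ℂ) : Prop :=
  ∃ y : ℝ → Fin 2 → ℂ, InDomain V a b σ y ∧
    ¬ (y =ᵐ[volume.restrict (Icc a b)] 0) ∧
    L V y =ᵐ[volume.restrict (Icc a b)] μ • y

/-- `E` is a `2ω`-periodic eigenvalue associated with `Q` (along the line through `x₀`): with
`t = ω/|ω|`, `tE` is an eigenvalue of the periodic problem for `t Q(tζ + x₀)` on `[0, 2|ω|]`. -/
def IsPeriodicEigenvalue (p q : ℂ → ℂ) (x₀ ω E : ℂ) : Prop :=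
  IsEigenvalue (lineQ p q x₀ ω) 0 (2 * ‖ω‖) 1 (dir ω * E)

/-- `E` is a `2ω`-semi-periodic eigenvalue: boundary condition `y(2|ω|) = -y(0)`. -/
def IsSemiPeriodicEigenvalue (p q : ℂ → ℂ) (x₀ ω E : ℂ) : Prop :=
  IsEigenvalue (lineQ p q x₀ ω) 0 (2 * ‖ω‖) (-1) (dir ω * E)

/-- `E` is a `4ω`-periodic eigenvalue: periodic boundary condition on `[0, 4|ω|]`. -/
def IsDoublePeriodicEigenvalue (p q : ℂ → ℂ) (x₀ ω E : ℂ) : Prop :=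
  IsEigenvalue (lineQ p q x₀ ω) 0 (4 * ‖ω‖) 1 (dir ω * E)

/-- The strip `{E : |Im (tE)| ≤ C}`. -/
def strip (t : ℂ) (C : ℝ) : Set ℂ := {E | |(t * E).im| ≤ C}

/-- The axis (middle line) `{E : Im (tE) = 0}` of the strips `{E : |Im (tE)| ≤ C}`. -/
def stripAxis (t : ℂ) : Set ℂ := {E | (t * E).im = 0}

/-- The lines `ℓ` and `ℓ'` through `0` meet at the angle `θ ∈ (0, π)`, measured counterclockwise
from `ℓ` to `ℓ'`. -/
def MeetAtAngle (ℓ ℓ' : Set ℂ) (θ : ℝ) : Prop :=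
  θ ∈ Ioo 0 Real.pi ∧ (fun E : ℂ => exp (θ * I) * E) '' ℓ = ℓ'

end AKNS

end

/-! Away from poles `Q_j` is continuous, so eigenfunctions are nonzero classical solutions of a
linear system with `2|ω_j|`-periodic coefficients. A `4ω`-periodic solution splits into its even and
odd parts under translation by `2|ω|`, which are `2ω`-periodic and semi-periodic
(`isEigenvalue_or_of_double`). For the strips, the derivative of `|y₀|² - |y₁|²` is `2 Im μ (|y₀|² +
|y₁|²)` plus a cross term bounded by the potential. For periodic `y` it integrates to zero, which
bounds `Im μ` (`abs_im_le_of_isEigenvalue`). The angle comes from `dir ω₃ = exp(iθ) · dir ω₁` with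
`θ = arg (ω₃/ω₁)`. -/

namespace AKNS

/-! ### The equation `Ly = μy` as a first order system; weak and classical solutions. -/

variable {V : ℝ → Matrix (Fin 2) (Fin 2) ℂ} {a b T : ℝ} {σ μ : ℂ}

/-- The vector field of the first order system `y' = -J (μ - V) y` equivalent to `Ly = μy`. -/
def field (V : ℝ → Matrix (Fin 2) (Fin 2) ℂ) (μ : ℂ) (x : ℝ) (v : Fin 2 → ℂ) : Fin 2 → ℂ :=
  ![-I * (μ * v 0 - (V x *ᵥ v) 0), I * (μ * v 1 - (V x *ᵥ v) 1)]

/-- A classical solution of `Ly = μy` on `[a, b]`. -/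
def IsSolution (V : ℝ → Matrix (Fin 2) (Fin 2) ℂ) (μ : ℂ) (a b : ℝ) (y : ℝ → Fin 2 → ℂ) : Prop :=
  ∀ x ∈ Icc a b, HasDerivAt y (field V μ x (y x)) x

lemma J_mulVec (v : Fin 2 → ℂ) : J *ᵥ v = ![I * v 0, -I * v 1] := by
  ext i; fin_cases i <;> simp [J, Matrix.mulVec, dotProduct, Fin.sum_univ_two]

lemma J_mulVec_add_eq_smul_iff (x : ℝ) (v w : Fin 2 → ℂ) :
    J *ᵥ w + V x *ᵥ v = μ • v ↔ w = field V μ x v := by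
  rw [J_mulVec, field]
  constructor
  · intro h
    have h0 := congrFun h 0
    have h1 := congrFun h 1
    simp only [Pi.add_apply, Pi.smul_apply, Matrix.cons_val_zero, Matrix.cons_val_one,
      smul_eq_mul] at h0 h1
    ext i; fin_cases i
    · simp only [Fin.zero_eta, Matrix.cons_val_zero]
      linear_combination (-I) * h0 + w 0 * I_mul_I
    · change w 1 = I * (μ * v 1 - (V x *ᵥ v) 1)
      linear_combination I * h1 + w 1 * I_mul_I
  · intro h
    subst h
    ext i; fin_cases i
    · simp only [Fin.zero_eta, Pi.add_apply, Pi.smul_apply, Matrix.cons_val_zero, smul_eq_mul]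
      linear_combination -(μ * v 0 - (V x *ᵥ v) 0) * I_mul_I
    · change -I * (I * (μ * v 1 - (V x *ᵥ v) 1)) + (V x *ᵥ v) 1 = μ * v 1
      linear_combination -(μ * v 1 - (V x *ᵥ v) 1) * I_mul_I

lemma field_add (x : ℝ) (v w : Fin 2 → ℂ) :
    field V μ x (v + w) = field V μ x v + field V μ x w := by
  ext i; fin_cases i <;> simp [field, Matrix.mulVec_add] <;> ring

lemma field_smul (x : ℝ) (c : ℂ) (v : Fin 2 → ℂ) :
    field V μ x (c • v) = c • field V μ x v := by
  ext i; fin_cases i <;> simp [field, Matrix.mulVec_smul] <;> ring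

lemma field_add_period (hT : ∀ x, V (x + T) = V x) (x : ℝ) (v : Fin 2 → ℂ) :
    field V μ (x + T) v = field V μ x v := by
  simp only [field, hT]

lemma continuousOn_field (hV : Continuous V) {s : Set ℝ} {y : ℝ → Fin 2 → ℂ}
    (hy : ContinuousOn y s) : ContinuousOn (fun x => field V μ x (y x)) s := by
  have hVy : ContinuousOn (fun x => V x *ᵥ y x) s := by
    rw [continuousOn_iff_continuous_domRestrict] at hy ⊢
    exact (hV.comp continuous_subtype_val).matrix_mulVec hy
  rw [continuousOn_pi] at hy hVy ⊢
  have h0 := hy 0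
  have h1 := hy 1
  have k0 := hVy 0
  have k1 := hVy 1
  intro i; fin_cases i
  · simp only [field, Fin.zero_eta, Matrix.cons_val_zero]; fun_prop
  · simp only [field, Fin.mk_one, Matrix.cons_val_one]; fun_prop

namespace IsSolution

variable {y z : ℝ → Fin 2 → ℂ}

lemma continuousOn (hy : IsSolution V μ a b y) : ContinuousOn y (Icc a b) :=
  fun x hx => (hy x hx).continuousAt.continuousWithinAt

lemma add (hy : IsSolution V μ a b y) (hz : IsSolution V μ a b z) :
    IsSolution V μ a b (fun x => y x + z x) := fun x hx => by
  rw [field_add]; exact (hy x hx).add (hz x hx)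

lemma const_smul (hy : IsSolution V μ a b y) (c : ℂ) :
    IsSolution V μ a b (fun x => c • y x) := fun x hx => by
  rw [field_smul]; exact (hy x hx).const_smul c

lemma mono {c d : ℝ} (hy : IsSolution V μ a b y) (h : Icc c d ⊆ Icc a b) :
    IsSolution V μ c d y := fun x hx => hy x (h hx)

lemma comp_add_period (hT : ∀ x, V (x + T) = V x) (hy : IsSolution V μ (a + T) (b + T) y) :
    IsSolution V μ a b (fun x => y (x + T)) := fun x hx => by
  have h := hy (x + T) ⟨by linarith [hx.1], by linarith [hx.2]⟩
  rw [field_add_period hT] at h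
  exact h.comp_add_const x T

lemma absolutelyContinuousOnInterval (hV : Continuous V) (hab : a < b)
    (hy : IsSolution V μ a b y) : AbsolutelyContinuousOnInterval y a b := by
  apply ContDiffOn.absolutelyContinuousOnInterval
  rw [uIcc_of_le hab.le, contDiffOn_one_iff_derivWithin (uniqueDiffOn_Icc hab)]
  refine ⟨fun x hx => (hy x hx).differentiableAt.differentiableWithinAt, ?_⟩
  refine (continuousOn_field (μ := μ) hV hy.continuousOn).congr fun x hx => ?_
  exact (hy x hx).hasDerivWithinAt.derivWithin (uniqueDiffOn_Icc hab x hx)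

end IsSolution

/-- Absolutely continuous solutions of the system agree with classical ones. -/
lemma exists_isSolution_eqOn (hV : Continuous V) (hab : a ≤ b) {y : ℝ → Fin 2 → ℂ}
    (hy : AbsolutelyContinuousOnInterval y a b)
    (hL : L V y =ᵐ[volume.restrict (Icc a b)] μ • y) :
    ∃ z, IsSolution V μ a b z ∧ EqOn y z (Icc a b) := by
  have hyc : ContinuousOn y (Icc a b) := by simpa [uIcc_of_le hab] using hy.continuousOn
  have hfc : ContinuousOn (fun x => field V μ x (y x)) (Icc a b) := continuousOn_field hV hyc
  -- Constant extension beyond `[a, b]` gives the primitive `F` a two-sided derivative at the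
  -- endpoints as well.
  set g : ℝ → Fin 2 → ℂ := IccExtend hab ((Icc a b).domRestrict fun x => field V μ x (y x)) with hg
  have hgc : Continuous g := (continuousOn_iff_continuous_domRestrict.1 hfc).Icc_extend'
  have hgeq : ∀ x ∈ Icc a b, g x = field V μ x (y x) := fun x hx => by
    rw [hg, IccExtend_of_mem _ _ hx]; rfl
  set F : ℝ → Fin 2 → ℂ := fun x => ∫ s in a..x, g s with hF
  have hFd : ∀ x, HasDerivAt F (g x) x := fun x => hgc.integral_hasStrictDerivAt a x |>.hasDerivAt
  have hFac : AbsolutelyContinuousOnInterval F a b := by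
    apply ContDiffOn.absolutelyContinuousOnInterval
    apply ContDiff.contDiffOn
    rw [contDiff_one_iff_deriv]
    refine ⟨fun x => (hFd x).differentiableAt, ?_⟩
    rwa [show deriv F = g from funext fun x => (hFd x).deriv]
  -- Bounded variation makes `y` differentiable almost everywhere, so `deriv y` is a true derivative
  -- there and not the default `0`.
  have hzero : ∀ᵐ x, x ∈ uIcc a b → HasDerivAt (y - F) 0 x := by
    rw [Filter.EventuallyEq, ae_restrict_iff' measurableSet_Icc] at hL
    filter_upwards [hL, hy.boundedVariationOn.ae_differentiableAt_of_mem_uIcc] with x h1 h2 hx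
    have hx' : x ∈ Icc a b := by rwa [uIcc_of_le hab] at hx
    have h3 := (h2 hx).hasDerivAt
    rw [(J_mulVec_add_eq_smul_iff x _ _).1 (h1 hx'), ← hgeq x hx'] at h3
    simpa using h3.sub (hFd x)
  obtain ⟨C, hC⟩ := (hy.sub hFac).const_of_ae_hasDerivAt_zero hzero
  rw [uIcc_of_le hab] at hC
  have heq : EqOn y (fun x => F x + C) (Icc a b) := fun x hx => by
    simp [← hC x hx]
  refine ⟨fun x => F x + C, fun x hx => ?_, heq⟩
  have h := (hFd x).add_const C
  rw [hgeq x hx, heq hx] at h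
  exact h

/-- Eigenvalues are characterized by classical solutions. -/
lemma isEigenvalue_iff_exists_isSolution (hV : Continuous V) (hab : a < b) :
    IsEigenvalue V a b σ μ ↔
      ∃ y, IsSolution V μ a b y ∧ (∃ x ∈ Icc a b, y x ≠ 0) ∧ y b = σ • y a := by
  have ha : a ∈ Icc a b := left_mem_Icc.2 hab.le
  have hb : b ∈ Icc a b := right_mem_Icc.2 hab.le
  constructor
  · rintro ⟨y, hdom, hne, hL⟩
    obtain ⟨z, hz, heq⟩ := exists_isSolution_eqOn hV hab.le hdom.absolutelyContinuous hL
    refine ⟨z, hz, ?_, by rw [← heq ha, ← heq hb, hdom.boundary]⟩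
    by_contra! h
    apply hne
    filter_upwards [ae_restrict_mem measurableSet_Icc] with x hx
    rw [heq hx, h x hx, Pi.zero_apply]
  · rintro ⟨y, hy, ⟨x, hx, hxne⟩, hbd⟩
    have hyp : MemLp y 2 (volume.restrict (Icc a b)) := by
      obtain ⟨C, hC⟩ := isCompact_Icc.exists_bound_of_continuousOn hy.continuousOn
      exact MemLp.of_bound (hy.continuousOn.aestronglyMeasurable measurableSet_Icc) C
        ((ae_restrict_mem measurableSet_Icc).mono hC)
    have hL : L V y =ᵐ[volume.restrict (Icc a b)] μ • y := by
      filter_upwards [ae_restrict_mem measurableSet_Icc] with x hx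
      exact (J_mulVec_add_eq_smul_iff x _ _).2 (hy x hx).deriv
    refine ⟨y, ⟨hyp, hy.absolutelyContinuousOnInterval hV hab, hbd,
      (hyp.const_smul μ).ae_eq hL.symm⟩, fun h => hxne ?_, hL⟩
    exact Measure.eqOn_Icc_of_ae_eq volume hab.ne h hy.continuousOn continuousOn_const hx

/-! ### Floquet theory: one period against two. -/

/-- Continuation of a solution over one further period by its Floquet multiplier. -/
lemma IsSolution.exists_extension (hT : ∀ x, V (x + T) = V x) (hT0 : 0 < T)
    {y : ℝ → Fin 2 → ℂ} (hy : IsSolution V μ 0 T y) (hbd : y T = σ • y 0) :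
    ∃ z, IsSolution V μ 0 (2 * T) z ∧ EqOn z y (Icc 0 T) ∧ z (2 * T) = σ • y T := by
  set z : ℝ → Fin 2 → ℂ := fun x => if x ≤ T then y x else σ • y (x - T) with hz
  have hzl : ∀ x, x ≤ T → z x = y x := fun x hx => if_pos hx
  -- At the seam `x = T` both formulas agree because of the boundary condition.
  have hzr : ∀ x, T ≤ x → z x = σ • y (x - T) := fun x hx => by
    rcases hx.eq_or_lt with rfl | hx
    · rw [hzl _ le_rfl, sub_self, hbd]
    · exact if_neg hx.not_ge
  have hleft : ∀ x ∈ Icc 0 T, HasDerivWithinAt z (field V μ x (z x)) (Iic T) x := fun x hx => by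
    rw [hzl x hx.2]
    exact (hy x hx).hasDerivWithinAt.congr (fun w hw => hzl w hw) (hzl x hx.2)
  have hright : ∀ x ∈ Icc T (2 * T), HasDerivWithinAt z (field V μ x (z x)) (Ici T) x :=
    fun x hx => by
    have h := ((hy (x - T) ⟨by linarith [hx.1], by linarith [hx.2]⟩).comp_sub_const x T).const_smul σ
    rw [← field_smul, ← field_add_period hT, sub_add_cancel, ← hzr x hx.1] at h
    exact h.hasDerivWithinAt.congr (fun w hw => hzr w hw) (hzr x hx.1)
  refine ⟨z, fun x hx => ?_, fun x hx => hzl x hx.2, ?_⟩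
  · rcases lt_trichotomy x T with h | rfl | h
    · exact (hleft x ⟨hx.1, h.le⟩).hasDerivAt (Iic_mem_nhds h)
    · have := (hleft x ⟨hx.1, le_rfl⟩).union (hright x ⟨le_rfl, hx.2⟩)
      rwa [Iic_union_Ici, hasDerivWithinAt_univ] at this
    · exact (hright x ⟨h.le, hx.2⟩).hasDerivAt (Ici_mem_nhds h)
  · rw [hzr _ (by linarith)]; congr 2; ring

lemma isEigenvalue_double_of_sq_eq_one (hV : Continuous V) (hT : ∀ x, V (x + T) = V x)
    (hT0 : 0 < T) (hσ : σ * σ = 1) (h : IsEigenvalue V 0 T σ μ) :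
    IsEigenvalue V 0 (2 * T) 1 μ := by
  rw [isEigenvalue_iff_exists_isSolution hV (by linarith)] at h ⊢
  obtain ⟨y, hy, ⟨x, hx, hne⟩, hbd⟩ := h
  obtain ⟨z, hz, heq, hz2⟩ := hy.exists_extension hT hT0 hbd
  refine ⟨z, hz, ⟨x, ⟨hx.1, by linarith [hx.2]⟩, by rwa [heq hx]⟩, ?_⟩
  rw [hz2, hbd, heq (left_mem_Icc.2 hT0.le), smul_smul, hσ]

lemma isEigenvalue_or_of_double (hV : Continuous V) (hT : ∀ x, V (x + T) = V x)
    (hT0 : 0 < T) (h : IsEigenvalue V 0 (2 * T) 1 μ) :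
    IsEigenvalue V 0 T 1 μ ∨ IsEigenvalue V 0 T (-1) μ := by
  rw [isEigenvalue_iff_exists_isSolution hV (by linarith)] at h
  rw [isEigenvalue_iff_exists_isSolution hV hT0, isEigenvalue_iff_exists_isSolution hV hT0]
  obtain ⟨y, hy, ⟨x, hx, hne⟩, hbd⟩ := h
  have h0 : IsSolution V μ 0 T y := hy.mono (Icc_subset_Icc le_rfl (by linarith))
  have h1 : IsSolution V μ 0 T (fun x => y (x + T)) :=
    (hy.mono (Icc_subset_Icc (by linarith) (by linarith))).comp_add_period hT
  have hTT : y (T + T) = y 0 := by rw [← two_mul, hbd, one_smul]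
  -- `y` may vanish on the first period a priori, so both halves are tracked.
  have key : ∃ w ∈ Icc 0 T, y w ≠ 0 ∨ y (w + T) ≠ 0 := by
    rcases le_total x T with h | h
    · exact ⟨x, ⟨hx.1, h⟩, Or.inl hne⟩
    · exact ⟨x - T, ⟨by linarith, by linarith [hx.2]⟩, Or.inr (by rwa [sub_add_cancel])⟩
  obtain ⟨w, hw, hwne⟩ := key
  by_cases hp : y w + y (w + T) = 0
  · refine Or.inr ⟨_, h0.add (h1.const_smul (-1)), ⟨w, hw, fun hm => ?_⟩, ?_⟩
    -- If sum and difference both vanished at `w`, so would `y w` and `y (w + T)`.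
    · have e1 : y (w + T) = -y w := (neg_eq_of_add_eq_zero_right hp).symm
      have e2 : (2 : ℂ) • y w = 0 := by rw [← hm, e1]; module
      have e3 : y w = 0 := (smul_eq_zero.1 e2).resolve_left two_ne_zero
      rw [e1, e3] at hwne
      simp at hwne
    · simp only [hTT, zero_add]; module
  · exact Or.inl ⟨_, h0.add h1, ⟨w, hw, hp⟩, by simp only [hTT, zero_add]; module⟩

/-! ### The energy estimate for `Im μ`. -/

lemma hasDerivAt_normSq {f : ℝ → ℂ} {f' : ℂ} {x : ℝ} (hf : HasDerivAt f f' x) :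
    HasDerivAt (fun x => normSq (f x)) (2 * (star (f x) * f').re) x := by
  have hre : HasDerivAt (fun x => (f x).re) f'.re x := reCLM.hasFDerivAt.comp_hasDerivAt x hf
  have him : HasDerivAt (fun x => (f x).im) f'.im x := imCLM.hasFDerivAt.comp_hasDerivAt x hf
  convert! (hre.mul hre).add (him.mul him) using 1
  simp; ring

/-- The eigenvalues of the periodic problem with off-diagonal potential bounded by `K` lie in
the strip `|Im μ| ≤ K`. -/
lemma abs_im_le_of_isEigenvalue (hV : Continuous V) (hab : a < b) {K : ℝ}
    (hd0 : ∀ x, V x 0 0 = 0) (hd1 : ∀ x, V x 1 1 = 0)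
    (h01 : ∀ x ∈ Icc a b, ‖V x 0 1‖ ≤ K) (h10 : ∀ x ∈ Icc a b, ‖V x 1 0‖ ≤ K)
    (h : IsEigenvalue V a b 1 μ) : |μ.im| ≤ K := by
  rw [isEigenvalue_iff_exists_isSolution hV hab] at h
  obtain ⟨y, hy, ⟨c, hc, hne⟩, hbd⟩ := h
  by_contra! hK
  obtain ⟨s, hs1, hs⟩ : ∃ s : ℝ, |s| = 1 ∧ s * μ.im = |μ.im| := by
    rcases le_total 0 μ.im with h | h
    · exact ⟨1, by simp, by simp [abs_of_nonneg h]⟩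
    · exact ⟨-1, by simp, by simp [abs_of_nonpos h]⟩
  -- With `s` the sign of `Im μ`, this is the derivative of `s (|y₀|² - |y₁|²)`, so its integral
  -- vanishes by periodicity.
  set e : ℝ → ℝ := fun x =>
    s * (2 * (star (y x 0) * field V μ x (y x) 0).re -
      2 * (star (y x 1) * field V μ x (y x) 1).re) with he
  have hder : ∀ x ∈ Icc a b,
      HasDerivAt (fun x => s * (normSq (y x 0) - normSq (y x 1))) (e x) x := fun x hx => by
    have h2 := hasDerivAt_pi.1 (hy x hx)
    exact ((hasDerivAt_normSq (h2 0)).sub (hasDerivAt_normSq (h2 1))).const_mul s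
  have hec : ContinuousOn e (Icc a b) := by
    have h1 := continuousOn_pi.1 hy.continuousOn
    have h2 := continuousOn_pi.1 (continuousOn_field (μ := μ) hV hy.continuousOn)
    have a0 := h1 0
    have a1 := h1 1
    have b0 := h2 0
    have b1 := h2 1
    exact continuousOn_const.mul ((continuousOn_const.mul
      (continuous_re.comp_continuousOn (a0.star.mul b0))).sub (continuousOn_const.mul
      (continuous_re.comp_continuousOn (a1.star.mul b1))))
  have hlow : ∀ x ∈ Icc a b, 2 * (|μ.im| - K) * (‖y x 0‖ ^ 2 + ‖y x 1‖ ^ 2) ≤ e x := by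
    intro x hx
    have hform : e x = 2 * (|μ.im| * (‖y x 0‖ ^ 2 + ‖y x 1‖ ^ 2) -
        s * (star (y x 0) * (V x 0 1 * y x 1) + star (y x 1) * (V x 1 0 * y x 0)).im) := by
      simp only [he, field, Matrix.mulVec, dotProduct, Fin.sum_univ_two, hd0, hd1, ← hs,
        ← normSq_eq_norm_sq, normSq_apply]
      simp
      ring
    have hb0 : |s * (star (y x 0) * (V x 0 1 * y x 1) + star (y x 1) * (V x 1 0 * y x 0)).im| ≤
        K * (‖y x 0‖ ^ 2 + ‖y x 1‖ ^ 2) := by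
      rw [abs_mul, hs1, one_mul]
      refine (abs_im_le_norm _).trans ((norm_add_le _ _).trans ?_)
      simp only [norm_mul, norm_star]
      have k0 := norm_nonneg (y x 0)
      have k1 := norm_nonneg (y x 1)
      have kk : 0 ≤ ‖y x 0‖ * ‖y x 1‖ := mul_nonneg k0 k1
      have hK0 : 0 ≤ K := (norm_nonneg _).trans (h01 x hx)
      have m1 := mul_le_mul_of_nonneg_right (h01 x hx) kk
      have m2 := mul_le_mul_of_nonneg_right (h10 x hx) kk
      -- `2|y₀||y₁| ≤ |y₀|² + |y₁|²` absorbs the cross terms.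
      have m3 := mul_nonneg hK0 (sq_nonneg (‖y x 0‖ - ‖y x 1‖))
      nlinarith
    rw [hform]
    have := (abs_le.1 hb0).2
    linarith
  have hN : ∀ x, 0 ≤ ‖y x 0‖ ^ 2 + ‖y x 1‖ ^ 2 := fun x => by positivity
  have hNc : 0 < ‖y c 0‖ ^ 2 + ‖y c 1‖ ^ 2 := by
    refine lt_of_le_of_ne (hN c) fun h0 => hne ?_
    have n0 : ‖y c 0‖ = 0 := by nlinarith [sq_nonneg ‖y c 0‖, sq_nonneg ‖y c 1‖]
    have n1 : ‖y c 1‖ = 0 := by nlinarith [sq_nonneg ‖y c 0‖, sq_nonneg ‖y c 1‖]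
    ext i; fin_cases i
    · exact norm_eq_zero.1 n0
    · exact norm_eq_zero.1 n1
  have hpos : 0 < ∫ x in a..b, e x :=
    intervalIntegral.integral_pos hab hec
      (fun x hx => (mul_nonneg (by linarith) (hN x)).trans (hlow x (Ioc_subset_Icc_self hx)))
      ⟨c, hc, (mul_pos (by linarith) hNc).trans_le (hlow c hc)⟩
  rw [intervalIntegral.integral_eq_sub_of_hasDerivAt (by rwa [uIcc_of_le hab.le])
    (by rw [← uIcc_of_le hab.le] at hec; exact hec.intervalIntegrable), hbd] at hpos
  simp at hpos

/-! ### Elliptic potentials restricted to a line. -/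

section Elliptic

variable {ω₁ ω₃ ω x₀ : ℂ} {p q f : ℂ → ℂ}

lemma norm_dir (hω : ω ≠ 0) : ‖dir ω‖ = 1 := by
  simp [dir, norm_ne_zero_iff.2 hω]

lemma dir_mul_norm (hω : ω ≠ 0) : dir ω * (‖ω‖ : ℂ) = ω :=
  div_mul_cancel₀ _ (by simpa using hω)

/-- Normal form is essential here: it rules out wrong values at removable singularities. -/
lemma IsElliptic.analyticAt (hf : IsElliptic ω₁ ω₃ f) {z : ℂ} (hz : ¬ IsPole f z) :
    AnalyticAt ℂ f z :=
  (hf.meromorphic (mem_univ z)).meromorphicOrderAt_nonneg_iff_analyticAt.1 (not_lt.1 hz)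

lemma IsElliptic.continuous_line (hf : IsElliptic ω₁ ω₃ f)
    (h : ∀ s : ℝ, ¬ IsPole f (dir ω * s + x₀)) :
    Continuous fun s : ℝ => f (dir ω * s + x₀) :=
  continuous_iff_continuousAt.2 fun s =>
    (hf.analyticAt (h s)).continuousAt.comp (f := fun s : ℝ => dir ω * s + x₀)
      (Continuous.continuousAt (by fun_prop))

lemma continuous_lineQ (hp : IsElliptic ω₁ ω₃ p) (hq : IsElliptic ω₁ ω₃ q)
    (h : NoPoleOnLine p q x₀ ω) : Continuous (lineQ p q x₀ ω) := by
  have h1 := hp.continuous_line fun s => (h s).1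
  have h2 := hq.continuous_line fun s => (h s).2
  have hQ : Continuous fun s : ℝ => Q p q (dir ω * s + x₀) := continuous_matrix fun i j => ?_
  · exact hQ.const_smul (dir ω)
  fin_cases i <;> fin_cases j
  · exact continuous_const
  · exact continuous_const.mul h2
  · exact continuous_const.mul h1
  · exact continuous_const

lemma IsElliptic.periodic_of_mem (hf : IsElliptic ω₁ ω₃ f) (hω : ω ∈ ({ω₁, ω₃} : Set ℂ)) (z : ℂ) :
    f (z + 2 * ω) = f z := by
  rcases hω with rfl | rfl
  · exact hf.periodic₁ z
  · exact hf.periodic₃ z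

lemma lineQ_add_period (hp : ∀ z, p (z + 2 * ω) = p z) (hq : ∀ z, q (z + 2 * ω) = q z)
    (hω : ω ≠ 0) (ζ : ℝ) : lineQ p q x₀ ω (ζ + 2 * ‖ω‖) = lineQ p q x₀ ω ζ := by
  have h : dir ω * ((ζ + 2 * ‖ω‖ : ℝ) : ℂ) + x₀ = dir ω * ζ + x₀ + 2 * ω := by
    push_cast
    linear_combination 2 * dir_mul_norm hω
  simp only [lineQ, Q, h, hp, hq]

lemma isDoublePeriodicEigenvalue_iff (hp : IsElliptic ω₁ ω₃ p) (hq : IsElliptic ω₁ ω₃ q)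
    (hω : ω ∈ ({ω₁, ω₃} : Set ℂ)) (hω0 : ω ≠ 0) (h : NoPoleOnLine p q x₀ ω) (E : ℂ) :
    IsDoublePeriodicEigenvalue p q x₀ ω E ↔
      IsPeriodicEigenvalue p q x₀ ω E ∨ IsSemiPeriodicEigenvalue p q x₀ ω E := by
  have hV := continuous_lineQ hp hq h
  have hT := lineQ_add_period (x₀ := x₀) (hp.periodic_of_mem hω) (hq.periodic_of_mem hω) hω0
  have hT0 : 0 < 2 * ‖ω‖ := by positivity
  have h4 : 4 * ‖ω‖ = 2 * (2 * ‖ω‖) := by ring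
  rw [IsDoublePeriodicEigenvalue, h4]
  refine ⟨isEigenvalue_or_of_double hV hT hT0, ?_⟩
  rintro (h | h)
  · exact isEigenvalue_double_of_sq_eq_one hV hT hT0 (by norm_num) h
  · exact isEigenvalue_double_of_sq_eq_one hV hT hT0 (by norm_num) h

lemma exists_strip_of_isDoublePeriodicEigenvalue (hp : IsElliptic ω₁ ω₃ p)
    (hq : IsElliptic ω₁ ω₃ q) (hω0 : ω ≠ 0) (h : NoPoleOnLine p q x₀ ω) :
    ∃ C : ℝ, 0 < C ∧ ∀ E : ℂ, IsDoublePeriodicEigenvalue p q x₀ ω E → E ∈ strip (dir ω) C := by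
  have hV := continuous_lineQ hp hq h
  have h4 : 0 < 4 * ‖ω‖ := by positivity
  obtain ⟨A, hA⟩ := (isCompact_Icc (a := 0) (b := 4 * ‖ω‖)).exists_bound_of_continuousOn
    (hV.matrix_elem 0 1).continuousOn
  obtain ⟨B, hB⟩ := (isCompact_Icc (a := 0) (b := 4 * ‖ω‖)).exists_bound_of_continuousOn
    (hV.matrix_elem 1 0).continuousOn
  -- The `1` only ensures that the constant is positive.
  refine ⟨max (max A B) 1, by positivity, fun E hE => ?_⟩
  exact abs_im_le_of_isEigenvalue hV h4 (fun x => by simp [lineQ, Q])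
    (fun x => by simp [lineQ, Q])
    (fun x hx => (hA x hx).trans ((le_max_left _ _).trans (le_max_left _ _)))
    (fun x hx => (hB x hx).trans ((le_max_right _ _).trans (le_max_left _ _))) hE

end Elliptic

/-! ### Plane geometry of the two strips. -/

section Strips

variable {ω₁ ω₃ : ℂ}

lemma arg_mem_Ioo_of_im_pos {z : ℂ} (hz : 0 < z.im) : arg z ∈ Ioo 0 Real.pi := by
  refine ⟨lt_of_le_of_ne (arg_nonneg_iff.2 hz.le) fun h => ?_,
    lt_of_le_of_ne (arg_le_pi z) fun h => ?_⟩
  · exact hz.ne' (arg_eq_zero_iff.1 h.symm).2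
  · exact hz.ne' (arg_eq_pi_iff.1 h).2

lemma exp_arg_mul_I {z : ℂ} (hz : z ≠ 0) : exp (arg z * I) = z * (‖z⁻¹‖ : ℂ) := by
  have h : (‖z‖ : ℂ) ≠ 0 := by simpa using hz
  rw [norm_inv, ofReal_inv, ← div_eq_mul_inv, eq_div_iff h, mul_comm, norm_mul_exp_arg_mul_I]

lemma dir_eq_rotation_mul_dir (h₁ : ω₁ ≠ 0) (h₃ : ω₃ ≠ 0) {r : ℂ}
    (hr : r = ω₃ / ω₁ * (‖ω₁ / ω₃‖ : ℂ)) : dir ω₃ = r * dir ω₁ := by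
  have n1 : (‖ω₁‖ : ℂ) ≠ 0 := by simpa using h₁
  have n3 : (‖ω₃‖ : ℂ) ≠ 0 := by simpa using h₃
  rw [hr, dir, dir, norm_div, ofReal_div]
  field_simp

/-- Both conditions test the same product, as `(r t) F = t (r F)`. -/
lemma image_mul_stripAxis {t r : ℂ} (hr : r ≠ 0) :
    (fun E : ℂ => r * E) '' stripAxis (r * t) = stripAxis t := by
  ext E
  simp only [stripAxis, mem_image, mem_ofPred_eq]
  constructor
  · rintro ⟨F, hF, rfl⟩
    rwa [← mul_assoc, mul_comm t]
  · intro h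
    refine ⟨r⁻¹ * E, ?_, mul_inv_cancel_left₀ hr E⟩
    rwa [show r * t * (r⁻¹ * E) = t * E by field_simp]

/-- Two strips whose axes meet at an angle `θ ∈ (0, π)` have bounded intersection. -/
lemma norm_le_of_mem_strip_inter {t E : ℂ} (ht : ‖t‖ = 1) {θ C₁ C₃ : ℝ}
    (hθ : θ ∈ Ioo 0 Real.pi) (h₁ : E ∈ strip t C₁) (h₃ : E ∈ strip (exp (θ * I) * t) C₃) :
    ‖E‖ ≤ (C₁ + C₃) / Real.sin θ + C₁ := by
  have hs := Real.sin_pos_of_mem_Ioo hθ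
  rw [strip, mem_ofPred_eq] at h₁ h₃
  rw [mul_assoc] at h₃
  have hE : ‖E‖ = ‖t * E‖ := by rw [norm_mul, ht, one_mul]
  rw [hE]
  generalize t * E = w at *
  -- Once `Im w` is bounded, this bounds `Re w` because `sin θ > 0`.
  have h₃' : |Real.cos θ * w.im + Real.sin θ * w.re| ≤ C₃ := by
    rwa [mul_im, exp_ofReal_mul_I_re, exp_ofReal_mul_I_im] at h₃
  have hre : |w.re| ≤ (C₁ + C₃) / Real.sin θ := by
    rw [le_div_iff₀ hs]
    calc |w.re| * Real.sin θ
        = |(Real.cos θ * w.im + Real.sin θ * w.re) - Real.cos θ * w.im| := by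
          rw [add_sub_cancel_left, abs_mul, abs_of_pos hs, mul_comm]
      _ ≤ |Real.cos θ * w.im + Real.sin θ * w.re| + |Real.cos θ * w.im| := abs_sub _ _
      _ ≤ C₃ + 1 * C₁ := by
          rw [abs_mul]
          gcongr
          exact Real.abs_cos_le_one θ
      _ = C₁ + C₃ := by ring
  exact (norm_le_abs_re_add_abs_im w).trans (add_le_add hre h₁)

end Strips

end AKNS

theorem theoremt5p3 (ω₁ ω₃ : ℂ) (hω : 0 < (ω₃ / ω₁).im)
    (p q : ℂ → ℂ) (hp : AKNS.IsElliptic ω₁ ω₃ p) (hq : AKNS.IsElliptic ω₁ ω₃ q)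
    (x₀ : ℂ) (h₁ : AKNS.NoPoleOnLine p q x₀ ω₁) (h₃ : AKNS.NoPoleOnLine p q x₀ ω₃) :
    (∀ ω ∈ ({ω₁, ω₃} : Set ℂ), ∀ E : ℂ,
      AKNS.IsDoublePeriodicEigenvalue p q x₀ ω E ↔
        AKNS.IsPeriodicEigenvalue p q x₀ ω E ∨ AKNS.IsSemiPeriodicEigenvalue p q x₀ ω E) ∧
    ∃ C₁ C₃ : ℝ, 0 < C₁ ∧ 0 < C₃ ∧
      (∀ E : ℂ, AKNS.IsDoublePeriodicEigenvalue p q x₀ ω₁ E → E ∈ AKNS.strip (AKNS.dir ω₁) C₁) ∧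
      (∀ E : ℂ, AKNS.IsDoublePeriodicEigenvalue p q x₀ ω₃ E → E ∈ AKNS.strip (AKNS.dir ω₃) C₃) ∧
      (∃ θ : ℝ, θ ∈ Set.Ioo 0 Real.pi ∧
        Complex.exp (θ * Complex.I) = ω₃ / ω₁ * (‖ω₁ / ω₃‖ : ℂ) ∧
        AKNS.MeetAtAngle (AKNS.stripAxis (AKNS.dir ω₃)) (AKNS.stripAxis (AKNS.dir ω₁)) θ) ∧
      ∃ R : ℝ, 0 < R ∧ ∀ E : ℂ, R < ‖E‖ →
        E ∉ AKNS.strip (AKNS.dir ω₁) C₁ ∩ AKNS.strip (AKNS.dir ω₃) C₃ := by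
  have hz : ω₃ / ω₁ ≠ 0 := fun h => by simp [h] at hω
  obtain ⟨h3, h1⟩ := div_ne_zero_iff.1 hz
  obtain ⟨C₁, hC₁, hs₁⟩ :=
    AKNS.exists_strip_of_isDoublePeriodicEigenvalue hp hq h1 h₁
  obtain ⟨C₃, hC₃, hs₃⟩ :=
    AKNS.exists_strip_of_isDoublePeriodicEigenvalue hp hq h3 h₃
  have hθ := AKNS.arg_mem_Ioo_of_im_pos hω
  have hexp := AKNS.exp_arg_mul_I hz
  rw [inv_div] at hexp
  have hdir := AKNS.dir_eq_rotation_mul_dir h1 h3 hexp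
  refine ⟨?_, C₁, C₃, hC₁, hC₃, hs₁, hs₃, ⟨_, hθ, hexp, hθ, ?_⟩, ?_⟩
  · rintro ω hmem E
    rcases hmem with rfl | rfl
    · exact AKNS.isDoublePeriodicEigenvalue_iff hp hq (Set.mem_insert _ _) h1 h₁ E
    · exact AKNS.isDoublePeriodicEigenvalue_iff hp hq (Set.mem_insert_of_mem _ rfl) h3 h₃ E
  · rw [hdir]
    exact AKNS.image_mul_stripAxis (Complex.exp_ne_zero _)
  · have hs := Real.sin_pos_of_mem_Ioo hθ
    refine ⟨(C₁ + C₃) / Real.sin (Complex.arg (ω₃ / ω₁)) + C₁, by positivity,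
      fun E hE hmem => hE.not_ge ?_⟩
    exact AKNS.norm_le_of_mem_strip_inter (AKNS.norm_dir h1) hθ hmem.1 (hdir ▸ hmem.2)
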